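/- Let $X=\{1,\dots,n\}$ be a finite set of clocks. A valuation is a map $v\colon X\to\mathbb{R}_{\ge 0}$. A zone is the set of valuations satisfying a finite conjunction of constraints of the form $x\sim c$ or $x-y\sim c$ with $x,y\in X$, $c\in\mathbb{Z}$ and $\sim\,\in\{<,\le,=,\ge,>\}$. A priced zone is a pair $\mathcal{Z}=(Z,\zeta)$ of a zone $Z$ and an affine function $\zeta\colon\mathbb{R}_{\ge 0}^X\to\mathbb{R}$. Let $M\colon X\to\mathbb{N}\cup\{-\infty\}$. For valuations $v,v'$ write $v\equiv_M v'$ if for every $x\in X$ either $v(x)=v'(x)$, or both $v(x)>M(x)$ and $v'(x)>M(x)$. For priced zones $\mathcal{Z}=(Z,\zeta)$ and $\mathcal{Z}'=(Z',\zeta')$ write $\mathcal{Z}\sqsubseteq_M\mathcal{Z}'$ if \[ \forall v\in Z\ \ \forall\varepsilon>0\ \ \exists v'\in Z'\colon\quad v\equiv_M v'\ \text{ and }\ \zeta'(v')\le\zeta(v)+\varepsilon . \] Corollary. The relation $\sqsubseteq_M$ is effectively decidable: there is a single algorithm (a total computable function) which, given $n$, $M$, and two priced zones $\mathcal{Z},\mathcal{Z}'$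 over $n$ clocks, each presented by a finite list of constraints defining its zone and by the coefficients and constant term of its cost function, these being rational numbers, decides whether $\mathcal{Z}\sqsubseteq_M\mathcal{Z}'$. -/

import Mathlib

open scoped NNReal

namespace PricedZones

/-- Clock valuations over `X`: mappings from clocks to non-negative reals. -/
abbrev Valuation (X : Type) : Type := X → ℝ≥0

/-- The comparison symbols that may occur in a constraint. -/
inductive Cmp : Type
  | lt | le | eq | ge | gt

/-- The relation on the reals denoted by a comparison symbol. -/
def Cmp.Holds : Cmp → ℝ → ℝ → Prop
  | .lt, a, b => a < b
  | .le, a, b => a ≤ b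
  | .eq, a, b => a = b
  | .ge, a, b => a ≥ b
  | .gt, a, b => a > b

/-- Atomic generalized clock constraints: `x ∼ c` and `x - y ∼ c`, with `c` an integer. -/
inductive Atom (X : Type) : Type
  | bound (x : X) (op : Cmp) (c : ℤ)
  | diff (x y : X) (op : Cmp) (c : ℤ)

/-- Satisfaction of an atomic constraint by a valuation. -/
def Atom.Sat {X : Type} (v : Valuation X) : Atom X → Prop
  | .bound x op c => op.Holds (v x : ℝ) (c : ℝ)
  | .diff x y op c => op.Holds ((v x : ℝ) - (v y : ℝ)) (c : ℝ)

/-- Generalized clock constraints: finite conjunctions of atomic constraints. -/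
abbrev Constraint (X : Type) : Type := List (Atom X)

/-- The set of valuations that satisfy a generalized constraint. -/
def Constraint.solutions {X : Type} (γ : Constraint X) : Set (Valuation X) :=
  {v | ∀ a ∈ γ, a.Sat v}

/-- A zone is a set of valuations defined by a generalized constraint. -/
def IsZone {X : Type} (Z : Set (Valuation X)) : Prop :=
  ∃ γ : Constraint X, Z = γ.solutions

/-- The affine function on valuations with the given (real) coefficients and constant term. -/
def affine {X : Type} [Fintype X] (a : X → ℝ) (b : ℝ) (v : Valuation X) : ℝ :=
  ∑ x, a x * (v x : ℝ) + b

/-- A priced zone: a zone together with an affine cost function. -/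
structure PricedZone (X : Type) [Fintype X] : Type where
  zone : Set (Valuation X)
  cost : Valuation X → ℝ
  isZone : IsZone zone
  isAffine : ∃ (a : X → ℝ) (b : ℝ), cost = affine a b

/-- `v ≡_M v'`: on every clock `x` the two valuations agree, or both exceed `M x`
(where `M x = ⊥` stands for `-∞`, which every value exceeds). -/
def Equivalent {X : Type} (M : X → WithBot ℕ) (v v' : Valuation X) : Prop :=
  ∀ x, v x = v' x ∨
    ((M x).map (fun k : ℕ => (k : ℝ≥0)) < (v x : WithBot ℝ≥0) ∧
      (M x).map (fun k : ℕ => (k : ℝ≥0)) < (v' x : WithBot ℝ≥0))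

/-- The inclusion test `𝒵 ⊑_M 𝒵'` between priced zones. -/
def Included {X : Type} [Fintype X] (M : X → WithBot ℕ) (Z Z' : PricedZone X) : Prop :=
  ∀ v ∈ Z.zone, ∀ ε : ℝ, 0 < ε →
    ∃ v' ∈ Z'.zone, Equivalent M v v' ∧ Z'.cost v' ≤ Z.cost v + ε

/-! ### Finite presentations of priced zones -/

/-- A finite presentation of a priced zone over the clocks `0, …, n - 1`: a generalized constraint,
and the rational coefficients and constant term of the cost function. -/
structure Presentation (n : ℕ) : Type where
  constraint : Constraint (Fin n)
  coeff : Fin n → ℚ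
  const : ℚ

/-- The priced zone that a presentation presents. -/
def Presentation.toPricedZone {n : ℕ} (P : Presentation n) : PricedZone (Fin n) where
  zone := P.constraint.solutions
  cost := affine (fun x => (P.coeff x : ℝ)) (P.const : ℝ)
  isZone := ⟨P.constraint, rfl⟩
  isAffine := ⟨fun x => (P.coeff x : ℝ), (P.const : ℝ), rfl⟩

/-! ### Concrete inputs of the decision problem

The inputs are written out as lists and tuples of natural numbers and integers, so that one
algorithm can be run on inputs with any number of clocks. -/

/-- The number that stands for a comparison symbol. -/
def Cmp.code : Cmp → ℕ
  | .lt => 0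
  | .le => 1
  | .eq => 2
  | .ge => 3
  | .gt => 4

/-- A rational number is written as its numerator and its denominator. -/
def ratCode (q : ℚ) : ℤ × ℕ := (q.num, q.den)

/-- An atomic constraint is written as its clock(s), its comparison symbol and its constant. -/
def Atom.code {n : ℕ} : Atom (Fin n) → (ℕ × Option ℕ) × (ℕ × ℤ)
  | .bound x op c => (((x : ℕ), none), (op.code, c))
  | .diff x y op c => (((x : ℕ), some (y : ℕ)), (op.code, c))

/-- The codes of presentations: the atomic constraints, the list of the coefficients, and the
constant term. -/
abbrev PresentationCode : Type :=
  List ((ℕ × Option ℕ) × (ℕ × ℤ)) × (List (ℤ × ℕ) × (ℤ × ℕ))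

def Presentation.code {n : ℕ} (P : Presentation n) : PresentationCode :=
  (P.constraint.map Atom.code, (List.ofFn fun x => ratCode (P.coeff x), ratCode P.const))

/-- The bounds `M 0, …, M (n - 1)` are written as a list; `none` stands for `-∞`. -/
def boundsCode {n : ℕ} (M : Fin n → WithBot ℕ) : List (Option ℕ) :=
  List.ofFn fun x => (WithBot.recBotCoe none some (M x) : Option ℕ)

/-- The inputs: the number of clocks, the bounds `M`, and two presentations. -/
abbrev Input : Type :=
  ℕ × (List (Option ℕ) × (PresentationCode × PresentationCode))

def input {n : ℕ} (M : Fin n → WithBot ℕ) (P P' : Presentation n) : Input :=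
  (n, (boundsCode M, (P.code, P'.code)))

end PricedZones

/-!
# Decidability of inclusion of priced zones

The inclusion `𝒵 ⊑_M 𝒵'` fails iff there are `v ∈ Z` and `ε > 0` such that no `v' ∈ Z'` satisfies
both `v ≡_M v'` and `ζ' v' ≤ ζ v + ε`. After multiplication by a common denominator of the cost
coefficients, everything except `≡_M` is a conjunction of linear inequalities with integer
coefficients in the values of the clocks under `v` and `v'` and in `ε`. The relation `≡_M` becomes
such a conjunction after a distinction of cases: if `v x ≤ M x`, it demands `v' x = v x` at the
clock `x`; if `v x > M x`, it demands `v' x > M x` (`holds_snd_of_mem_splitClocks`).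

So in each case there are an outer system `S(v, ε)` and an inner system `T(v, ε, v')`, and it has to
be decided whether some `(v, ε)` satisfies `S` but not `∃ v', T`. Fourier–Motzkin elimination
(`System.holds_elims`) turns `∃ v', T` into a conjunction of inequalities `c(v, ε)`. A
counterexample exists iff for one of these `c` the system consisting of `S` and the negation of `c`,
which is again an inequality, is satisfiable; a second elimination, of all the variables, reduces
this to the comparison of integers with zero (`entails_eq_false`). Elimination is exact over the
reals, strict inequalities included, because finitely many lower and upper bounds on one real
variable are compatible as soon as they are so in pairs (`exists_between_bounds`).

Systems are lists of inequalities between sparse linear forms, so that the whole procedure is a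
composition of maps, filters and folds of lists; it is even primitive recursive
(`primrec_decideIncluded`).
-/

/-! ### Primitive recursive integer arithmetic -/

namespace PricedZones

theorem encode_int (z : ℤ) :
    Encodable.encode z = if 0 ≤ z then 2 * z.toNat else 2 * ((-z).toNat - 1) + 1 := by
  cases z with
  | ofNat n => simp; rfl
  | negSucc n =>
    have h : ¬ (0 ≤ Int.negSucc n) := by omega
    rw [if_neg h]
    have : (-Int.negSucc n).toNat - 1 = n := by omega
    rw [this]; rfl

theorem primrec_natCast_sub : Primrec₂ fun a b : ℕ => (a : ℤ) - b := by
  refine Primrec.encode_iff.1 ?_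
  refine (Primrec.ite (Primrec.nat_le.comp Primrec.snd Primrec.fst)
    (Primrec.nat_double.comp (Primrec.nat_sub.comp Primrec.fst Primrec.snd))
    (Primrec.nat_double_succ.comp (Primrec.nat_sub.comp
      (Primrec.nat_sub.comp Primrec.snd Primrec.fst) (Primrec.const 1)))).of_eq fun p => ?_
  rw [encode_int]
  dsimp only
  split_ifs <;> omega

theorem primrec_toNat : Primrec Int.toNat := by
  refine (Primrec.ite (c := fun z : ℤ => Encodable.encode z % 2 = 0)
    (Primrec.eq.comp (Primrec.nat_mod.comp Primrec.encode (Primrec.const 2)) (Primrec.const 0))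
    (Primrec.nat_div.comp Primrec.encode (Primrec.const 2)) (Primrec.const 0)).of_eq fun z => ?_
  rw [encode_int]
  split_ifs <;> omega

theorem primrec_neg_toNat : Primrec fun z : ℤ => (-z).toNat := by
  refine (Primrec.ite (c := fun z : ℤ => Encodable.encode z % 2 = 0)
    (Primrec.eq.comp (Primrec.nat_mod.comp Primrec.encode (Primrec.const 2)) (Primrec.const 0))
    (Primrec.const 0) (Primrec.nat_div.comp (Primrec.succ.comp Primrec.encode)
      (Primrec.const 2))).of_eq fun z => ?_
  rw [encode_int]
  split_ifs <;> omega

theorem primrec_int_neg : Primrec fun z : ℤ => -z :=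
  (primrec_natCast_sub.comp primrec_neg_toNat primrec_toNat).of_eq fun z => by omega

theorem primrec_int_add : Primrec₂ fun a b : ℤ => a + b :=
  (primrec_natCast_sub.comp
    (Primrec.nat_add.comp (primrec_toNat.comp Primrec.fst) (primrec_toNat.comp Primrec.snd))
    (Primrec.nat_add.comp (primrec_neg_toNat.comp Primrec.fst)
      (primrec_neg_toNat.comp Primrec.snd))).of_eq fun p => by
    dsimp only
    omega

theorem primrec_int_mul : Primrec₂ fun a b : ℤ => a * b :=
  (primrec_natCast_sub.comp
    (Primrec.nat_add.comp
      (Primrec.nat_mul.comp (primrec_toNat.comp Primrec.fst) (primrec_toNat.comp Primrec.snd))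
      (Primrec.nat_mul.comp (primrec_neg_toNat.comp Primrec.fst)
        (primrec_neg_toNat.comp Primrec.snd)))
    (Primrec.nat_add.comp
      (Primrec.nat_mul.comp (primrec_toNat.comp Primrec.fst) (primrec_neg_toNat.comp Primrec.snd))
      (Primrec.nat_mul.comp (primrec_neg_toNat.comp Primrec.fst)
        (primrec_toNat.comp Primrec.snd)))).of_eq fun p => by
    obtain ⟨a, b⟩ := p
    have ha : a = (a.toNat : ℤ) - (-a).toNat := by omega
    have hb : b = (b.toNat : ℤ) - (-b).toNat := by omega
    conv_rhs => rw [ha, hb]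
    push_cast
    ring

theorem primrec_natCast_int : Primrec fun n : ℕ => (n : ℤ) :=
  (primrec_natCast_sub.comp Primrec.id (Primrec.const 0)).of_eq fun n => by simp

theorem primrec_int_pos : PrimrecPred fun z : ℤ => 0 < z :=
  (Primrec.nat_lt.comp (Primrec.const 0) primrec_toNat).of_eq fun z => by omega

theorem primrec_int_nonneg : PrimrecPred fun z : ℤ => 0 ≤ z :=
  (Primrec.eq.comp primrec_neg_toNat (Primrec.const 0)).of_eq fun z => by omega

/-! ### Primitive recursive list operations with parameters -/

section Lists

variable {α β : Type*} [Primcodable α] [Primcodable β]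

theorem primrec_list_filter {f : α → List β} {p : α → β → Bool} (hf : Primrec f)
    (hp : Primrec₂ p) : Primrec fun a => (f a).filter (p a) :=
  (Primrec.listFilterMap (g := fun a b => bif p a b then some b else none) hf
    (Primrec.cond hp (Primrec.option_some.comp Primrec.snd) (Primrec.const none))).of_eq
    fun a => by
      rw [← List.filterMap_eq_filter]
      congr 1
      funext b
      cases h : p a b <;> simp [Option.guard, h]

theorem primrec_list_all {f : α → List β} {p : α → β → Bool} (hf : Primrec f)
    (hp : Primrec₂ p) : Primrec fun a => (f a).all (p a) :=
  (Primrec.list_foldr (h := fun a x => p a x.1 && x.2) hf (Primrec.const true)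
    (Primrec.and.comp (hp.comp Primrec.fst (Primrec.fst.comp Primrec.snd))
      (Primrec.snd.comp Primrec.snd))).of_eq fun a => by
    induction f a with
    | nil => rfl
    | cons b l ih => rw [List.foldr_cons, ih, List.all_cons]

end Lists

/-! ### Systems of linear inequalities -/

/-- A linear form in variables indexed by `ℕ`, as a list of monomials (coefficient, variable).
A variable may occur several times. -/
abbrev LinForm : Type := List (ℤ × ℕ)

/-- A homogeneous linear inequality: `(t, true)` stands for `0 < t` and `(t, false)` for `0 ≤ t`.
Constants are written as multiples of the variable `0`, which is assigned the value `1`. -/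
abbrev Ineq : Type := LinForm × Bool

/-- A finite conjunction of linear inequalities. -/
abbrev System : Type := List Ineq

/-- The value of a linear form under an assignment of reals to the variables. -/
def LinForm.eval (e : ℕ → ℝ) : LinForm → ℝ
  | [] => 0
  | m :: t => m.1 * e m.2 + LinForm.eval e t

/-- The total coefficient of the variable `j` in a linear form. -/
def LinForm.coeff (j : ℕ) (t : LinForm) : ℤ :=
  t.foldr (fun m s => if m.2 = j then m.1 + s else s) 0

/-- The multiple of a linear form by an integer. -/
def LinForm.scale (k : ℤ) (t : LinForm) : LinForm := t.map fun m => (k * m.1, m.2)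

/-- `0 < x` or `0 ≤ x`, according to whether `s` asks for a strict inequality. -/
def Positive (s : Bool) (x : ℝ) : Prop := if s then 0 < x else 0 ≤ x

/-- Satisfaction of a linear inequality by an assignment. -/
def Ineq.Holds (e : ℕ → ℝ) (r : Ineq) : Prop := Positive r.2 (LinForm.eval e r.1)

/-- Satisfaction of all inequalities of a system by an assignment. -/
def System.Holds (e : ℕ → ℝ) (S : System) : Prop := ∀ r ∈ S, Ineq.Holds e r

/-- The inequality that holds exactly where `r` fails. -/
def Ineq.not (r : Ineq) : Ineq := (LinForm.scale (-1) r.1, !r.2)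

@[simp] theorem LinForm.eval_nil (e : ℕ → ℝ) : LinForm.eval e [] = 0 := rfl

@[simp] theorem LinForm.eval_cons (e : ℕ → ℝ) (m : ℤ × ℕ) (t : LinForm) :
    LinForm.eval e (m :: t) = m.1 * e m.2 + LinForm.eval e t := rfl

@[simp] theorem LinForm.eval_append (e : ℕ → ℝ) (t u : LinForm) :
    LinForm.eval e (t ++ u) = LinForm.eval e t + LinForm.eval e u := by
  induction t with
  | nil => simp
  | cons m t ih => simp [ih, add_assoc]

@[simp] theorem LinForm.eval_scale (e : ℕ → ℝ) (k : ℤ) (t : LinForm) :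
    LinForm.eval e (LinForm.scale k t) = k * LinForm.eval e t := by
  induction t with
  | nil => simp [LinForm.scale]
  | cons m t ih =>
    change ((k * m.1 : ℤ) : ℝ) * e m.2 + LinForm.eval e (LinForm.scale k t) = _
    rw [ih, LinForm.eval_cons]
    push_cast
    ring

theorem LinForm.eval_update (e : ℕ → ℝ) (j : ℕ) (x : ℝ) (t : LinForm) :
    LinForm.eval (Function.update e j x) t
      = LinForm.eval e t + LinForm.coeff j t * (x - e j) := by
  induction t with
  | nil => simp [LinForm.coeff]
  | cons m t ih =>
    have hc : LinForm.coeff j (m :: t)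
        = if m.2 = j then m.1 + LinForm.coeff j t else LinForm.coeff j t := rfl
    rw [LinForm.eval_cons, LinForm.eval_cons, ih, hc]
    by_cases h : m.2 = j
    · rw [if_pos h, h, Function.update_self]
      push_cast
      ring
    · rw [if_neg h, Function.update_of_ne h]
      ring

theorem LinForm.eval_single (t : LinForm) :
    LinForm.eval (Pi.single 0 1) t = LinForm.coeff 0 t := by
  have h : LinForm.eval 0 t = 0 := by
    induction t with
    | nil => rfl
    | cons m t ih => simp [ih]
  rw [Pi.single, LinForm.eval_update, h]
  simp

@[simp] theorem System.holds_cons (e : ℕ → ℝ) (r : Ineq) (S : System) :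
    System.Holds e (r :: S) ↔ Ineq.Holds e r ∧ System.Holds e S := by
  simp [System.Holds]

@[simp] theorem System.holds_append (e : ℕ → ℝ) (S T : System) :
    System.Holds e (S ++ T) ↔ System.Holds e S ∧ System.Holds e T := by
  simp [System.Holds, or_imp, forall_and]

@[simp] theorem System.holds_nil (e : ℕ → ℝ) : System.Holds e [] := by
  simp [System.Holds]

@[simp] theorem Ineq.holds_strict (e : ℕ → ℝ) (t : LinForm) :
    Ineq.Holds e (t, true) ↔ 0 < LinForm.eval e t := by
  simp [Ineq.Holds, Positive]

@[simp] theorem Ineq.holds_weak (e : ℕ → ℝ) (t : LinForm) :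
    Ineq.Holds e (t, false) ↔ 0 ≤ LinForm.eval e t := by
  simp [Ineq.Holds, Positive]

theorem Ineq.holds_not (e : ℕ → ℝ) (r : Ineq) : Ineq.Holds e r.not ↔ ¬ Ineq.Holds e r := by
  obtain ⟨t, s⟩ := r
  cases s <;> simp [Ineq.not]

/-! ### Fourier–Motzkin elimination -/

theorem Positive.mul {s : Bool} {k x : ℝ} (hk : 0 < k) (h : Positive s x) :
    Positive s (k * x) := by
  cases s
  · simp only [Positive, Bool.false_eq_true, if_false] at *; positivity
  · simp only [Positive, if_true] at *; positivity

theorem Positive.add {s s' : Bool} {x y : ℝ} (h : Positive s x) (h' : Positive s' y) :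
    Positive (s || s') (x + y) := by
  cases s <;> cases s' <;> simp [Positive] at * <;> linarith

theorem positive_mul_iff {s : Bool} {k x : ℝ} (hk : 0 < k) :
    Positive s (k * x) ↔ Positive s x := by
  refine ⟨fun h => ?_, Positive.mul hk⟩
  simpa [hk.ne'] using h.mul (inv_pos.2 hk)

/-- Finitely many lower bounds and upper bounds, each strict or not, have a common solution as
soon as each lower bound is compatible with each upper bound: in dimension one, only the greatest
lower bound and the least upper bound matter. -/
theorem exists_between_bounds (A B : List (ℝ × Bool))
    (h : ∀ a ∈ A, ∀ b ∈ B, Positive (a.2 || b.2) (b.1 - a.1)) :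
    ∃ x : ℝ, (∀ a ∈ A, Positive a.2 (x - a.1)) ∧ ∀ b ∈ B, Positive b.2 (b.1 - x) := by
  have weaken : ∀ {s : Bool} {x : ℝ}, 0 < x → Positive s x := by
    intro s x hx
    cases s <;> simp [Positive, hx, hx.le]
  have nonneg : ∀ {s : Bool} {x : ℝ}, Positive s x → 0 ≤ x := by
    intro s x hx
    cases s <;> simp [Positive] at hx <;> linarith
  have above : ∃ u : ℝ, ∀ a ∈ A, a.1 < u := by
    obtain ⟨u, hu⟩ := (A.toFinset.image Prod.fst).bddAbove
    refine ⟨u + 1, fun a ha => ?_⟩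
    have : a.1 ≤ u := hu (Finset.mem_image_of_mem _ (List.mem_toFinset.2 ha))
    linarith
  have below : ∃ l : ℝ, ∀ b ∈ B, l < b.1 := by
    obtain ⟨l, hl⟩ := (B.toFinset.image Prod.fst).bddBelow
    refine ⟨l - 1, fun b hb => ?_⟩
    have : l ≤ b.1 := hl (Finset.mem_image_of_mem _ (List.mem_toFinset.2 hb))
    linarith
  rcases A.eq_nil_or_concat with rfl | ⟨A', a', hA⟩
  · obtain ⟨l, hl⟩ := below
    exact ⟨l, by simp, fun b hb => weaken (sub_pos.2 (hl b hb))⟩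
  rcases B.eq_nil_or_concat with rfl | ⟨B', b', hB⟩
  · obtain ⟨u, hu⟩ := above
    exact ⟨u, fun a ha => weaken (sub_pos.2 (hu a ha)), by simp⟩
  obtain ⟨a, ha, hmax⟩ := A.toFinset.exists_max_image Prod.fst ⟨a', by simp [hA]⟩
  obtain ⟨b, hb, hmin⟩ := B.toFinset.exists_min_image Prod.fst ⟨b', by simp [hB]⟩
  simp only [List.mem_toFinset] at ha hb hmax hmin
  rcases (sub_nonneg.1 (nonneg (h a ha b hb))).lt_or_eq with hlt | heq
  · refine ⟨(a.1 + b.1) / 2, fun c hc => weaken ?_, fun c hc => weaken ?_⟩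
    · have := hmax c hc
      linarith
    · have := hmin c hc
      linarith
  · -- The only candidate is the common value, so strict bounds must lie strictly off it.
    refine ⟨a.1, fun c hc => ?_, fun c hc => ?_⟩
    · have := h c hc b hb
      rw [← heq] at this
      cases hs : c.2
      · exact sub_nonneg.2 (hmax c hc)
      · simpa [hs] using this
    · have := h a ha c hc
      cases hs : c.2
      · have := hmin c hc
        exact sub_nonneg.2 (heq.le.trans this)
      · simpa [hs] using this

/-- The positive combination of `p` and `q` in which the variable `j` cancels, where `j` has a
positive coefficient in `p` and a negative one in `q`. -/
def Ineq.combine (j : ℕ) (p q : Ineq) : Ineq :=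
  (LinForm.scale (-(LinForm.coeff j q.1)) p.1 ++ LinForm.scale (LinForm.coeff j p.1) q.1,
    p.2 || q.2)

/-- Fourier–Motzkin elimination of the variable `j`. Monomials in `j` may remain, but their
coefficients sum to zero in each inequality. -/
def System.elim (j : ℕ) (S : System) : System :=
  S.filter (fun p => decide (LinForm.coeff j p.1 = 0)) ++
    (S.filter fun p => decide (0 < LinForm.coeff j p.1)).flatMap fun p =>
      (S.filter fun q => decide (0 < -(LinForm.coeff j q.1))).map fun q => Ineq.combine j p q

theorem System.holds_elim (e : ℕ → ℝ) (j : ℕ) (S : System) :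
    System.Holds e (System.elim j S) ↔ ∃ x, System.Holds (Function.update e j x) S := by
  have key : System.Holds e (System.elim j S) ↔
      (∀ p ∈ S, LinForm.coeff j p.1 = 0 → Ineq.Holds e p) ∧
      ∀ p ∈ S, 0 < LinForm.coeff j p.1 → ∀ q ∈ S, LinForm.coeff j q.1 < 0 →
        Ineq.Holds e (Ineq.combine j p q) := by
    rw [System.elim, System.holds_append]
    simp only [System.Holds, List.mem_filter, List.mem_flatMap, List.mem_map]
    constructor
    · rintro ⟨h₀, h₁⟩
      exact ⟨fun p hp h => h₀ p ⟨hp, by simpa using h⟩, fun p hp h q hq h' =>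
        h₁ _ ⟨p, ⟨hp, by simpa using h⟩, q, ⟨hq, by simpa using h'⟩, rfl⟩⟩
    · rintro ⟨h₀, h₁⟩
      refine ⟨fun p hp => h₀ p hp.1 (by simpa using hp.2), ?_⟩
      rintro _ ⟨p, ⟨hp, h⟩, q, ⟨hq, h'⟩, rfl⟩
      exact h₁ p hp (by simpa using h) q hq (by simpa using h')
  rw [key]
  constructor
  · rintro ⟨h₀, h₁⟩
    -- The value of `j` at which a linear form vanishes; it is a lower or an upper bound for the
    -- solutions according to the sign of the coefficient of `j`.
    let root : Ineq → ℝ := fun p => e j - LinForm.eval e p.1 / LinForm.coeff j p.1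
    obtain ⟨x, hA, hB⟩ := exists_between_bounds
      ((S.filter fun p => decide (0 < LinForm.coeff j p.1)).map fun p => (root p, p.2))
      ((S.filter fun q => decide (LinForm.coeff j q.1 < 0)).map fun q => (root q, q.2)) (by
        simp only [List.mem_map, List.mem_filter, decide_eq_true_eq]
        rintro _ ⟨p, ⟨hp, hpos⟩, rfl⟩ _ ⟨q, ⟨hq, hneg⟩, rfl⟩
        have h := h₁ p hp hpos q hq hneg
        have hpos' : (0 : ℝ) < LinForm.coeff j p.1 := by exact_mod_cast hpos
        have hneg' : (0 : ℝ) < -LinForm.coeff j q.1 := by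
          have : (LinForm.coeff j q.1 : ℝ) < 0 := by exact_mod_cast hneg
          linarith
        simp only [Ineq.Holds, Ineq.combine, LinForm.eval_append, LinForm.eval_scale] at h
        refine (positive_mul_iff (mul_pos hneg' hpos')).1 ?_
        convert h using 1
        simp only [root]
        have h2 : (LinForm.coeff j q.1 : ℝ) ≠ 0 := by
          intro h0
          rw [h0] at hneg'
          simp at hneg'
        field_simp
        push_cast
        ring)
    simp only [List.mem_map, List.mem_filter, decide_eq_true_eq] at hA hB
    refine ⟨x, fun p hp => ?_⟩
    rw [Ineq.Holds, LinForm.eval_update]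
    rcases lt_trichotomy (LinForm.coeff j p.1) 0 with hc | hc | hc
    · have h := hB _ ⟨p, ⟨hp, hc⟩, rfl⟩
      have hc' : (LinForm.coeff j p.1 : ℝ) < 0 := by exact_mod_cast hc
      have h' := h.mul (neg_pos.2 hc')
      convert h' using 1
      simp only [root]
      have := hc'.ne
      field_simp
      ring
    · have h := h₀ p hp hc
      simpa [hc, Ineq.Holds] using h
    · have h := hA _ ⟨p, ⟨hp, hc⟩, rfl⟩
      have hc' : (0 : ℝ) < LinForm.coeff j p.1 := by exact_mod_cast hc
      have h' := h.mul hc'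
      convert h' using 1
      simp only [root]
      have := hc'.ne'
      field_simp
      ring
  · rintro ⟨x, hx⟩
    refine ⟨fun p hp h => ?_, fun p hp hpos q hq hneg => ?_⟩
    · have := hx p hp
      rw [Ineq.Holds, LinForm.eval_update, h] at this
      simpa [Ineq.Holds] using this
    · have h := hx p hp
      have h' := hx q hq
      rw [Ineq.Holds, LinForm.eval_update] at h h'
      have hpos' : (0 : ℝ) < LinForm.coeff j p.1 := by exact_mod_cast hpos
      have hneg' : (LinForm.coeff j q.1 : ℝ) < 0 := by exact_mod_cast hneg
      have := (h.mul (neg_pos.2 hneg')).add (h'.mul hpos')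
      simp only [Ineq.Holds, Ineq.combine, LinForm.eval_append, LinForm.eval_scale]
      convert this using 1
      push_cast
      ring

/-- Successive elimination of a list of variables. -/
def System.elims (J : List ℕ) (S : System) : System := J.foldr System.elim S

theorem System.holds_elims (e : ℕ → ℝ) (J : List ℕ) (S : System) :
    System.Holds e (System.elims J S) ↔
      ∃ e' : ℕ → ℝ, (∀ i ∉ J, e' i = e i) ∧ System.Holds e' S := by
  induction J generalizing e with
  | nil =>
    refine ⟨fun h => ⟨e, fun _ _ => rfl, h⟩, ?_⟩
    rintro ⟨e', h, h'⟩
    have : e' = e := funext fun i => h i (by simp)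
    exact this ▸ h'
  | cons j J ih =>
    change System.Holds e (System.elim j (System.elims J S)) ↔ _
    rw [System.holds_elim]
    simp only [ih]
    constructor
    · rintro ⟨x, e', h, h'⟩
      refine ⟨e', fun i hi => ?_, h'⟩
      simp only [List.mem_cons, not_or] at hi
      rw [h i hi.2, Function.update_of_ne hi.1]
    · rintro ⟨e', h, h'⟩
      refine ⟨e' j, e', fun i hi => ?_, h'⟩
      by_cases hij : i = j
      · rw [hij, Function.update_self]
      · rw [Function.update_of_ne hij]
        exact h i (by simp [hij, hi])

/-- Test whether an inequality holds when the variable `0` is `1` and all others are `0`. -/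
def Ineq.test (r : Ineq) : Bool :=
  bif r.2 then decide (0 < LinForm.coeff 0 r.1) else decide (0 ≤ LinForm.coeff 0 r.1)

theorem Ineq.test_iff (r : Ineq) : Ineq.test r = true ↔ Ineq.Holds (Pi.single 0 1) r := by
  obtain ⟨t, s⟩ := r
  cases s <;> simp [Ineq.test, LinForm.eval_single]

theorem primrec_coeff : Primrec₂ LinForm.coeff :=
  Primrec.list_foldr (f := fun p : ℕ × LinForm => p.2) (g := fun _ => (0 : ℤ))
    (h := fun p x => if x.1.2 = p.1 then x.1.1 + x.2 else x.2) Primrec.snd (Primrec.const 0)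
    (Primrec.ite (c := fun z : (ℕ × LinForm) × ((ℤ × ℕ) × ℤ) => z.2.1.2 = z.1.1)
      (Primrec.eq.comp (Primrec.snd.comp (Primrec.fst.comp Primrec.snd))
        (Primrec.fst.comp Primrec.fst))
      (primrec_int_add.comp (Primrec.fst.comp (Primrec.fst.comp Primrec.snd))
        (Primrec.snd.comp Primrec.snd))
      (Primrec.snd.comp Primrec.snd))

theorem primrec_scale : Primrec₂ LinForm.scale :=
  Primrec.list_map (f := fun p : ℤ × LinForm => p.2)
    (g := fun p m => (p.1 * m.1, m.2)) Primrec.snd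
    ((primrec_int_mul.comp (Primrec.fst.comp Primrec.fst) (Primrec.fst.comp Primrec.snd)).pair
      (Primrec.snd.comp Primrec.snd))

theorem primrec_not : Primrec Ineq.not :=
  (primrec_scale.comp (Primrec.const (-1)) Primrec.fst).pair (Primrec.not.comp Primrec.snd)

theorem primrec_combine :
    Primrec fun z : ℕ × Ineq × Ineq => Ineq.combine z.1 z.2.1 z.2.2 := by
  have hp : Primrec fun z : ℕ × Ineq × Ineq => z.2.1 := Primrec.fst.comp Primrec.snd
  have hq : Primrec fun z : ℕ × Ineq × Ineq => z.2.2 := Primrec.snd.comp Primrec.snd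
  exact (Primrec.list_append.comp
    (primrec_scale.comp
      (primrec_int_neg.comp (primrec_coeff.comp Primrec.fst (Primrec.fst.comp hq)))
      (Primrec.fst.comp hp))
    (primrec_scale.comp (primrec_coeff.comp Primrec.fst (Primrec.fst.comp hp))
      (Primrec.fst.comp hq))).pair
    (Primrec.or.comp (Primrec.snd.comp hp) (Primrec.snd.comp hq))

theorem primrec_elim : Primrec₂ System.elim := by
  have hc : Primrec₂ fun (z : ℕ × System) (p : Ineq) => LinForm.coeff z.1 p.1 :=
    primrec_coeff.comp (Primrec.fst.comp Primrec.fst) (Primrec.fst.comp Primrec.snd)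
  have hzero : Primrec₂ fun (z : ℕ × System) (p : Ineq) => decide (LinForm.coeff z.1 p.1 = 0) :=
    (Primrec.eq.comp hc (Primrec.const 0)).decide
  have hpos : Primrec₂ fun (z : ℕ × System) (p : Ineq) => decide (0 < LinForm.coeff z.1 p.1) :=
    (primrec_int_pos.comp hc).decide
  have hneg : Primrec₂ fun (z : ℕ × System) (p : Ineq) =>
      decide (0 < -(LinForm.coeff z.1 p.1)) :=
    (primrec_int_pos.comp (primrec_int_neg.comp hc)).decide
  refine Primrec.list_append.comp (primrec_list_filter Primrec.snd hzero)
    (Primrec.list_flatMap (primrec_list_filter Primrec.snd hpos) ?_)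
  refine Primrec.list_map (β := Ineq) (f := fun w : (ℕ × System) × Ineq =>
    w.1.2.filter fun q => decide (0 < -(LinForm.coeff w.1.1 q.1)))
    ((primrec_list_filter Primrec.snd hneg).comp Primrec.fst) ?_
  exact primrec_combine.comp (α := ((ℕ × System) × Ineq) × Ineq)
    ((Primrec.fst.comp (Primrec.fst.comp Primrec.fst)).pair
      ((Primrec.snd.comp Primrec.fst).pair Primrec.snd))

theorem primrec_elims : Primrec₂ System.elims :=
  Primrec.list_foldr (f := fun z : List ℕ × System => z.1) (g := fun z => z.2)
    (h := fun _ x => System.elim x.1 x.2) Primrec.fst Primrec.snd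
    (primrec_elim.comp (Primrec.fst.comp Primrec.snd) (Primrec.snd.comp Primrec.snd))

theorem primrec_test : Primrec Ineq.test := by
  have hc : Primrec fun r : Ineq => LinForm.coeff 0 r.1 :=
    primrec_coeff.comp (Primrec.const 0) Primrec.fst
  exact Primrec.cond (α := Ineq) Primrec.snd (primrec_int_pos.comp hc).decide
    (primrec_int_nonneg.comp hc).decide

/-! ### Zones and cost functions as linear inequalities

The variable `0` stands for the constant `1`, the variable `1` for `ε`, and each clock `i` has two
variables: `clock 0 i` for its value under `v` and `clock 1 i` for its value under `v'`. -/

/-- The variable for the value of clock `i` under the first (`b = 0`) or the second (`b = 1`)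
valuation. -/
def clock (b i : ℕ) : ℕ := 2 * i + 2 + b

/-- The comparison of `t` with `0` by the comparison symbol with number `op`; every number from `4`
on is read as `>`. -/
def cmpSystem (op : ℕ) (t : LinForm) : System :=
  if op = 0 then [(LinForm.scale (-1) t, true)]
  else if op = 1 then [(LinForm.scale (-1) t, false)]
  else if op = 2 then [(t, false), (LinForm.scale (-1) t, false)]
  else if op = 3 then [(t, false)]
  else [(t, true)]

/-- The difference of the two sides of the atomic constraint with code `a`. -/
def atomForm (b : ℕ) (a : (ℕ × Option ℕ) × (ℕ × ℤ)) : LinForm :=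
  (1, clock b a.1.1) :: (-a.2.2, 0) ::
    (a.1.2.elim [] fun y => [((-1 : ℤ), clock b y)] : LinForm)

/-- The inequalities that define the zone with constraint code `γ` over `n` clocks; they include
the non-negativity of the clock values. -/
def zoneSystem (n b : ℕ) (γ : List ((ℕ × Option ℕ) × (ℕ × ℤ))) : System :=
  γ.flatMap (fun a => cmpSystem a.2.1 (atomForm b a)) ++
    (List.range n).map fun i => (([((1 : ℤ), clock b i)], false) : Ineq)

/-- The product of all denominators in the code of a cost function. -/
def denominator (c : List (ℤ × ℕ) × (ℤ × ℕ)) : ℕ := c.1.foldr (fun q d => q.2 * d) c.2.2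

/-- The cost function with code `c`, multiplied by the common denominator `d`. -/
def costForm (n d b : ℕ) (c : List (ℤ × ℕ) × (ℤ × ℕ)) : LinForm :=
  (c.2.1 * (d / c.2.2 : ℕ), 0) ::
    (List.range n).map fun i =>
      ((c.1.getD i (0, 1)).1 * (d / (c.1.getD i (0, 1)).2 : ℕ), clock b i)

theorem LinForm.eval_map_range (e : ℕ → ℝ) (n : ℕ) (f : ℕ → ℤ × ℕ) :
    LinForm.eval e ((List.range n).map f) = ∑ i : Fin n, ((f i).1 : ℝ) * e (f i).2 := by
  rw [← Finset.sum_range fun i => ((f i).1 : ℝ) * e (f i).2]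
  induction n with
  | zero => rfl
  | succ n ih => simp [List.range_succ, Finset.sum_range_succ, ih]

theorem holds_cmpSystem (e : ℕ → ℝ) (op : Cmp) (t : LinForm) (x y : ℝ)
    (h : LinForm.eval e t = x - y) : System.Holds e (cmpSystem op.code t) ↔ op.Holds x y := by
  cases op <;> simp [cmpSystem, Cmp.code, Cmp.Holds, h]
  exact ⟨fun h => le_antisymm h.2 h.1, fun h => ⟨h.ge, h.le⟩⟩

theorem holds_atom {n : ℕ} (e : ℕ → ℝ) (h₀ : e 0 = 1) (b : ℕ) (v : Valuation (Fin n))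
    (hv : ∀ i : Fin n, e (clock b i) = v i) (a : Atom (Fin n)) :
    System.Holds e (cmpSystem a.code.2.1 (atomForm b a.code)) ↔ a.Sat v := by
  cases a with
  | bound x op c =>
    refine holds_cmpSystem e op _ _ _ ?_
    simp [atomForm, Atom.code, h₀, hv]
    ring
  | diff x y op c =>
    refine holds_cmpSystem e op _ _ _ ?_
    simp [atomForm, Atom.code, h₀, hv]
    ring

theorem holds_zoneSystem {n : ℕ} (e : ℕ → ℝ) (h₀ : e 0 = 1) (b : ℕ) (γ : Constraint (Fin n)) :
    System.Holds e (zoneSystem n b (γ.map Atom.code)) ↔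
      ∃ v ∈ γ.solutions, ∀ i : Fin n, e (clock b i) = v i := by
  have hsat : ∀ v : Valuation (Fin n), (∀ i : Fin n, e (clock b i) = v i) →
      (System.Holds e ((γ.map Atom.code).flatMap fun a => cmpSystem a.2.1 (atomForm b a)) ↔
        v ∈ γ.solutions) := by
    intro v hv
    have : System.Holds e ((γ.map Atom.code).flatMap fun a => cmpSystem a.2.1 (atomForm b a)) ↔
        ∀ a ∈ γ, System.Holds e (cmpSystem a.code.2.1 (atomForm b a.code)) := by
      simp only [System.Holds, List.mem_flatMap, List.mem_map]
      grind
    rw [this]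
    exact forall₂_congr fun a _ => holds_atom e h₀ b v hv a
  have hnonneg : System.Holds e
      ((List.range n).map fun i => (([((1 : ℤ), clock b i)], false) : Ineq)) ↔
        ∀ i : Fin n, 0 ≤ e (clock b i) := by
    simp [System.Holds, Fin.forall_iff]
  rw [zoneSystem, System.holds_append, hnonneg]
  constructor
  · rintro ⟨h, hpos⟩
    exact ⟨fun i => ⟨e (clock b i), hpos i⟩, (hsat _ fun i => rfl).1 h, fun i => rfl⟩
  · rintro ⟨v, h, hv⟩
    exact ⟨(hsat v hv).2 h, fun i => hv i ▸ (v i).2⟩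

theorem denominator_pos {n : ℕ} (P : Presentation n) : 0 < denominator P.code.2 := by
  have : ∀ l : List (ℤ × ℕ), (∀ q ∈ l, 0 < q.2) →
      0 < l.foldr (fun q d => q.2 * d) P.const.den := by
    intro l hl
    induction l with
    | nil => exact P.const.den_pos
    | cons q l ih =>
      exact Nat.mul_pos (hl q (by simp)) (ih fun r hr => hl r (by simp [hr]))
  refine this _ fun q hq => ?_
  obtain ⟨i, rfl⟩ := (List.mem_ofFn' _ _).1 hq
  exact (P.coeff i).den_pos

theorem dvd_denominator (c : List (ℤ × ℕ) × (ℤ × ℕ)) :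
    c.2.2 ∣ denominator c ∧ ∀ q ∈ c.1, q.2 ∣ denominator c := by
  obtain ⟨l, r⟩ := c
  simp only [denominator]
  induction l with
  | nil => simp
  | cons q l ih =>
    refine ⟨ih.1.mul_left _, fun s hs => ?_⟩
    rcases List.mem_cons.1 hs with rfl | hs
    · exact dvd_mul_right _ _
    · exact (ih.2 s hs).mul_left _

theorem num_mul_div_den (q : ℚ) (d : ℕ) (h : q.den ∣ d) :
    (((q.num * (d / q.den : ℕ) : ℤ)) : ℝ) = d * (q : ℝ) := by
  obtain ⟨k, rfl⟩ := h
  rw [Nat.mul_div_cancel_left _ q.den_pos]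
  have h : (q.num : ℝ) = q * q.den := by exact_mod_cast (Rat.mul_den_eq_num q).symm
  push_cast
  rw [h]
  ring

theorem eval_costForm {n : ℕ} (e : ℕ → ℝ) (h₀ : e 0 = 1) (b d : ℕ) (P : Presentation n)
    (hd : denominator P.code.2 ∣ d) (v : Valuation (Fin n))
    (hv : ∀ i : Fin n, e (clock b i) = v i) :
    LinForm.eval e (costForm n d b P.code.2) = d * P.toPricedZone.cost v := by
  have hget : ∀ i : Fin n, P.code.2.1.getD i (0, 1) = ratCode (P.coeff i) := by
    intro i
    simp [Presentation.code, List.getD]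
  obtain ⟨hc, hl⟩ := dvd_denominator P.code.2
  have hconst : (((P.code.2.2.1 * (d / P.code.2.2.2 : ℕ) : ℤ)) : ℝ) = d * (P.const : ℝ) :=
    num_mul_div_den P.const d (hc.trans hd)
  rw [costForm, LinForm.eval_cons, LinForm.eval_map_range]
  simp only [hget, hv, h₀, hconst]
  change _ = d * (∑ i, (P.coeff i : ℝ) * (v i : ℝ) + P.const)
  rw [mul_add, Finset.mul_sum, add_comm, mul_one]
  congr 1
  refine Finset.sum_congr rfl fun i _ => ?_
  have hi : (P.coeff i).den ∣ d :=
    (hl (ratCode (P.coeff i)) ((List.mem_ofFn' _ _).2 ⟨i, rfl⟩)).trans hd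
  rw [← mul_assoc]
  congr 1
  exact num_mul_div_den (P.coeff i) d hi

/-! ### Case distinction on the clocks that exceed their bounds -/

/-- The two cases for clock `i`. The first component of a case restricts the first valuation; given
this restriction, the second component expresses `≡_M` at the clock `i` as a conjunction of linear
inequalities. -/
def splitClock (M : List (Option ℕ)) (i : ℕ) (p : System × System) : List (System × System) :=
  (M.getD i none).elim [p] fun k =>
    [(([((k : ℤ), 0), (-1, clock 0 i)], false) :: p.1,
      ([((1 : ℤ), clock 0 i), (-1, clock 1 i)], false) ::
        ([((1 : ℤ), clock 1 i), (-1, clock 0 i)], false) :: p.2),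
     (([((1 : ℤ), clock 0 i), (-(k : ℤ), 0)], true) :: p.1,
      ([((1 : ℤ), clock 1 i), (-(k : ℤ), 0)], true) :: p.2)]

/-- All cases for the clocks in a list. -/
def splitClocks (M : List (Option ℕ)) (is : List ℕ) (p : System × System) :
    List (System × System) :=
  is.foldr (fun i l => l.flatMap (splitClock M i)) [p]

/-- The relation `≡_M` at the clock `i`, between the two valuations described by `e`. -/
def MatchesAt (M : List (Option ℕ)) (e : ℕ → ℝ) (i : ℕ) : Prop :=
  (M.getD i none).elim True fun k =>
    e (clock 0 i) = e (clock 1 i) ∨ ((k : ℝ) < e (clock 0 i) ∧ (k : ℝ) < e (clock 1 i))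

theorem exists_splitClock (M : List (Option ℕ)) (i : ℕ) (p : System × System) (e : ℕ → ℝ)
    (h₀ : e 0 = 1) (h : System.Holds e p.1) : ∃ q ∈ splitClock M i p, System.Holds e q.1 := by
  cases hM : M.getD i none with
  | none => exact ⟨p, by simp only [splitClock, hM]; simp, h⟩
  | some k =>
    rcases le_or_gt (e (clock 0 i)) k with hk | hk
    · refine ⟨_, by simp only [splitClock, hM]; exact List.mem_cons_self, ?_⟩
      simp [h, h₀, hk]
    · refine ⟨_, by simp only [splitClock, hM]; exact List.mem_cons_of_mem _ List.mem_cons_self, ?_⟩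
      simp [h, h₀, hk]

theorem holds_of_mem_splitClock {M : List (Option ℕ)} {i : ℕ} {p q : System × System}
    (hq : q ∈ splitClock M i p) {e : ℕ → ℝ} (h : System.Holds e q.1) : System.Holds e p.1 := by
  cases hM : M.getD i none with
  | none =>
    simp only [splitClock, hM, Option.elim_none, List.mem_singleton] at hq
    exact hq ▸ h
  | some k =>
    simp only [splitClock, hM, Option.elim_some, List.mem_cons, List.not_mem_nil, or_false] at hq
    rcases hq with rfl | rfl <;> exact ((System.holds_cons _ _ _).1 h).2

theorem holds_snd_of_mem_splitClock {M : List (Option ℕ)} {i : ℕ} {p q : System × System}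
    (hq : q ∈ splitClock M i p) {e e' : ℕ → ℝ} (h₀ : e 0 = 1) (h₀' : e' 0 = 1)
    (he : e' (clock 0 i) = e (clock 0 i)) (h : System.Holds e q.1) :
    System.Holds e' q.2 ↔ System.Holds e' p.2 ∧ MatchesAt M e' i := by
  cases hM : M.getD i none with
  | none =>
    simp only [splitClock, hM, Option.elim_none, List.mem_singleton] at hq
    rw [hq, MatchesAt, hM, Option.elim_none, and_true]
  | some k =>
    simp only [splitClock, hM, Option.elim_some, List.mem_cons, List.not_mem_nil, or_false] at hq
    rcases hq with rfl | rfl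
    · simp only [System.holds_cons, Ineq.holds_weak, LinForm.eval_cons, LinForm.eval_nil, h₀,
        Int.cast_natCast, Int.cast_neg, Int.cast_one, MatchesAt, hM, Option.elim_some, he] at h ⊢
      constructor
      · rintro ⟨h₁, h₂, h₃⟩
        exact ⟨h₃, Or.inl (by linarith)⟩
      · rintro ⟨h₃, h₁ | h₁⟩
        · exact ⟨by linarith, by linarith, h₃⟩
        · linarith [h.1, h₁.1]
    · simp only [System.holds_cons, Ineq.holds_strict, LinForm.eval_cons, LinForm.eval_nil, h₀,
        h₀', Int.cast_natCast, Int.cast_neg, Int.cast_one, MatchesAt, hM, Option.elim_some, he]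
        at h ⊢
      constructor
      · rintro ⟨h₁, h₂⟩
        exact ⟨h₂, Or.inr ⟨by linarith [h.1], by linarith⟩⟩
      · rintro ⟨h₂, h₁ | h₁⟩
        · exact ⟨by linarith [h.1], h₂⟩
        · exact ⟨by linarith [h₁.2], h₂⟩

theorem mem_splitClocks_cons {M : List (Option ℕ)} {i : ℕ} {is : List ℕ}
    {p q : System × System} :
    q ∈ splitClocks M (i :: is) p ↔ ∃ r ∈ splitClocks M is p, q ∈ splitClock M i r :=
  List.mem_flatMap

theorem exists_splitClocks (M : List (Option ℕ)) (is : List ℕ) (p : System × System)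
    (e : ℕ → ℝ) (h₀ : e 0 = 1) (h : System.Holds e p.1) :
    ∃ q ∈ splitClocks M is p, System.Holds e q.1 := by
  induction is with
  | nil => exact ⟨p, by simp [splitClocks], h⟩
  | cons i is ih =>
    obtain ⟨r, hr, hr'⟩ := ih
    obtain ⟨q, hq, hq'⟩ := exists_splitClock M i r e h₀ hr'
    exact ⟨q, mem_splitClocks_cons.2 ⟨r, hr, hq⟩, hq'⟩

theorem holds_of_mem_splitClocks {M : List (Option ℕ)} {is : List ℕ} {p q : System × System}
    (hq : q ∈ splitClocks M is p) {e : ℕ → ℝ} (h : System.Holds e q.1) :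
    System.Holds e p.1 := by
  induction is generalizing q with
  | nil => exact List.mem_singleton.1 hq ▸ h
  | cons i is ih =>
    obtain ⟨r, hr, hq⟩ := mem_splitClocks_cons.1 hq
    exact ih hr (holds_of_mem_splitClock hq h)

theorem holds_snd_of_mem_splitClocks {M : List (Option ℕ)} {is : List ℕ}
    {p q : System × System} (hq : q ∈ splitClocks M is p) {e e' : ℕ → ℝ} (h₀ : e 0 = 1)
    (h₀' : e' 0 = 1) (he : ∀ i ∈ is, e' (clock 0 i) = e (clock 0 i))
    (h : System.Holds e q.1) :
    System.Holds e' q.2 ↔ System.Holds e' p.2 ∧ ∀ i ∈ is, MatchesAt M e' i := by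
  induction is generalizing q with
  | nil => simp [List.mem_singleton.1 hq]
  | cons i is ih =>
    obtain ⟨r, hr, hq⟩ := mem_splitClocks_cons.1 hq
    rw [holds_snd_of_mem_splitClock hq h₀ h₀' (he i (by simp)) h,
      ih hr (fun j hj => he j (by simp [hj])) (holds_of_mem_splitClock hq h)]
    simp only [List.mem_cons, forall_eq_or_imp]
    tauto

theorem forall_matchesAt {n : ℕ} (M : Fin n → WithBot ℕ) (e : ℕ → ℝ)
    (v v' : Valuation (Fin n)) (hv : ∀ i : Fin n, e (clock 0 i) = v i)
    (hv' : ∀ i : Fin n, e (clock 1 i) = v' i) :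
    (∀ i ∈ List.range n, MatchesAt (boundsCode M) e i) ↔ Equivalent M v v' := by
  have hget : ∀ i : Fin n, (boundsCode M).getD i none
      = (WithBot.recBotCoe none some (M i) : Option ℕ) := by
    intro i
    simp [boundsCode, List.getD]
  have key : ∀ i : Fin n, MatchesAt (boundsCode M) e i ↔ (v i = v' i ∨
      ((M i).map (fun k : ℕ => (k : ℝ≥0)) < (v i : WithBot ℝ≥0) ∧
        (M i).map (fun k : ℕ => (k : ℝ≥0)) < (v' i : WithBot ℝ≥0))) := by
    intro i
    rw [MatchesAt, hget, hv, hv']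
    cases M i with
    | bot =>
      simp [WithBot.bot_lt_coe]
    | coe k =>
      have hcast : ∀ x : ℝ≥0, (k : ℝ≥0) < x ↔ (k : ℝ) < x := fun x => by
        rw [← NNReal.coe_lt_coe, NNReal.coe_natCast]
      simp only [WithBot.recBotCoe_coe, Option.elim_some, WithBot.map_coe, WithBot.coe_lt_coe,
        hcast, NNReal.coe_inj]
  simp only [List.mem_range]
  exact ⟨fun h i => (key i).1 (h i i.2), fun h i hi => (key ⟨i, hi⟩).2 (h ⟨i, hi⟩)⟩

/-! ### The decision procedure -/

/-- The conditions on `(v, ε)`: `v ∈ Z` and `0 < ε`. -/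
def outerSystem (x : Input) : System :=
  ([((1 : ℤ), 1)], true) :: zoneSystem x.1 0 x.2.2.1.1

/-- The common denominator of the two cost functions. -/
def commonDenominator (x : Input) : ℕ := denominator x.2.2.1.2 * denominator x.2.2.2.2

/-- The conditions `v' ∈ Z'` and `ζ' v' ≤ ζ v + ε`, the latter multiplied by the common
denominator. -/
def innerSystem (x : Input) : System :=
  (costForm x.1 (commonDenominator x) 0 x.2.2.1.2 ++ (((commonDenominator x : ℕ) : ℤ), 1) ::
    LinForm.scale (-1) (costForm x.1 (commonDenominator x) 1 x.2.2.2.2), false) ::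
    zoneSystem x.1 1 x.2.2.2.1

/-- The variables for the second valuation. -/
def innerVars (n : ℕ) : List ℕ := (List.range n).map (clock 1)

/-- All variables except the constant `0`. -/
def allVars (n : ℕ) : List ℕ := (List.range (2 * n + 1)).map Nat.succ

/-- Whether the system `S` implies the system `T`, where the variable `0` is `1` and the variables
beyond those of the `n` clocks are `0`: no inequality `c` of `T` may be false at a solution
of `S`. -/
def entails (n : ℕ) (S T : System) : Bool :=
  T.all fun c => !((System.elims (allVars n) (c.not :: S)).all Ineq.test)

/-- The algorithm: in each case, eliminate the second valuation from the inner system and test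
whether each resulting inequality follows from the outer system. -/
def decideIncluded (x : Input) : Bool :=
  (splitClocks x.2.1 (List.range x.1) (outerSystem x, innerSystem x)).all fun q =>
    entails x.1 q.1 (System.elims (innerVars x.1) q.2)

theorem primrec_clock : Primrec₂ clock :=
  Primrec.nat_add.comp (Primrec.nat_add.comp
    (Primrec.nat_double.comp Primrec.snd) (Primrec.const 2)) Primrec.fst

theorem primrec_cmpSystem : Primrec₂ cmpSystem := by
  have hop : Primrec fun z : ℕ × LinForm => z.1 := Primrec.fst
  have ht : Primrec fun z : ℕ × LinForm => z.2 := Primrec.snd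
  have hneg : Primrec fun z : ℕ × LinForm => LinForm.scale (-1) z.2 :=
    primrec_scale.comp (Primrec.const (-1)) ht
  have one : ∀ {f : ℕ × LinForm → Ineq}, Primrec f → Primrec fun z => [f z] := fun h =>
    Primrec.list_cons.comp h (Primrec.const [])
  have is : ∀ k, PrimrecPred fun z : ℕ × LinForm => z.1 = k := fun k =>
    Primrec.eq.comp hop (Primrec.const k)
  exact Primrec.ite (is 0) (one (hneg.pair (Primrec.const true)))
    (Primrec.ite (is 1) (one (hneg.pair (Primrec.const false)))
      (Primrec.ite (is 2) (Primrec.list_cons.comp (ht.pair (Primrec.const false))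
        (one (hneg.pair (Primrec.const false))))
        (Primrec.ite (is 3) (one (ht.pair (Primrec.const false)))
          (one (ht.pair (Primrec.const true))))))

theorem primrec_monomial {α : Type*} [Primcodable α] {f : α → ℤ} {g : α → ℕ} {t : α → LinForm}
    (hf : Primrec f) (hg : Primrec g) (ht : Primrec t) :
    Primrec fun a => (((f a, g a) :: t a : LinForm)) :=
  Primrec.list_cons.comp (hf.pair hg) ht

theorem primrec_atomForm : Primrec₂ atomForm := by
  let α := ℕ × ((ℕ × Option ℕ) × (ℕ × ℤ))
  have hy : Primrec fun z : α => z.2.1.2 := Primrec.snd.comp (Primrec.fst.comp Primrec.snd)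
  have htail : Primrec fun z : α =>
      (z.2.1.2.elim [] fun y => [((-1 : ℤ), clock z.1 y)] : LinForm) := by
    have hcons : Primrec₂ fun (z : α) (y : ℕ) => ([((-1 : ℤ), clock z.1 y)] : LinForm) :=
      primrec_monomial (α := α × ℕ) (Primrec.const (-1))
        (primrec_clock.comp (Primrec.fst.comp Primrec.fst) Primrec.snd) (Primrec.const [])
    refine (Primrec.option_casesOn hy (Primrec.const ([] : LinForm)) hcons).of_eq fun z => ?_
    cases z.2.1.2 <;> rfl
  have hx : Primrec fun z : α => clock z.1 z.2.1.1 :=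
    primrec_clock.comp Primrec.fst (Primrec.fst.comp (Primrec.fst.comp Primrec.snd))
  have hc : Primrec fun z : α => -z.2.2.2 :=
    primrec_int_neg.comp (Primrec.snd.comp (Primrec.snd.comp Primrec.snd))
  exact primrec_monomial (Primrec.const 1) hx (primrec_monomial hc (Primrec.const 0) htail)

theorem primrec_zoneSystem (b : ℕ) : Primrec₂ fun n γ => zoneSystem n b γ := by
  let A := (ℕ × Option ℕ) × (ℕ × ℤ)
  refine Primrec.list_append.comp
    (Primrec.list_flatMap (α := ℕ × List A)
      (g := fun _ (a : A) => cmpSystem a.2.1 (atomForm b a)) Primrec.snd ?_)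
    (Primrec.list_map (α := ℕ × List A)
      (g := fun _ i => (([((1 : ℤ), clock b i)], false) : Ineq))
      (Primrec.list_range.comp Primrec.fst) ?_)
  · exact primrec_cmpSystem.comp (α := (ℕ × List A) × A)
      (Primrec.fst.comp (Primrec.snd.comp Primrec.snd))
      (primrec_atomForm.comp (Primrec.const b) Primrec.snd)
  · exact (primrec_monomial (α := (ℕ × List A) × ℕ) (Primrec.const 1)
      (primrec_clock.comp (Primrec.const b) Primrec.snd) (Primrec.const [])).pair
      (Primrec.const false)

theorem primrec_denominator : Primrec denominator :=
  Primrec.list_foldr (α := List (ℤ × ℕ) × (ℤ × ℕ)) (f := fun c => c.1) (g := fun c => c.2.2)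
    (h := fun _ x => x.1.2 * x.2) Primrec.fst
    (Primrec.snd.comp Primrec.snd)
    (Primrec.nat_mul.comp (Primrec.snd.comp (Primrec.fst.comp Primrec.snd))
      (Primrec.snd.comp Primrec.snd))

theorem primrec_costForm (b : ℕ) :
    Primrec fun z : ℕ × ℕ × (List (ℤ × ℕ) × (ℤ × ℕ)) => costForm z.1 z.2.1 b z.2.2 := by
  let α := ℕ × ℕ × (List (ℤ × ℕ) × (ℤ × ℕ))
  have hd : Primrec fun z : α => z.2.1 := Primrec.fst.comp Primrec.snd
  have hl : Primrec fun z : α => z.2.2.1 := Primrec.fst.comp (Primrec.snd.comp Primrec.snd)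
  have hc : Primrec fun z : α => z.2.2.2 := Primrec.snd.comp (Primrec.snd.comp Primrec.snd)
  have hscale : Primrec₂ fun (d : ℕ) (q : ℤ × ℕ) => q.1 * ((d / q.2 : ℕ) : ℤ) :=
    primrec_int_mul.comp (Primrec.fst.comp Primrec.snd)
      (primrec_natCast_int.comp (Primrec.nat_div.comp Primrec.fst (Primrec.snd.comp Primrec.snd)))
  refine primrec_monomial (α := α) (hscale.comp hd hc) (Primrec.const 0)
    (Primrec.list_map (α := α)
      (g := fun z i => ((z.2.2.1.getD i (0, 1)).1 * ((z.2.1 / (z.2.2.1.getD i (0, 1)).2 : ℕ) : ℤ),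
        clock b i)) (Primrec.list_range.comp Primrec.fst) ?_)
  exact (hscale.comp (α := α × ℕ) (hd.comp Primrec.fst)
    ((Primrec.list_getD (0, 1)).comp (hl.comp Primrec.fst) Primrec.snd)).pair
    (primrec_clock.comp (Primrec.const b) Primrec.snd)

theorem primrec_splitClock :
    Primrec fun z : List (Option ℕ) × ℕ × (System × System) => splitClock z.1 z.2.1 z.2.2 := by
  let α := List (Option ℕ) × ℕ × (System × System)
  have hM : Primrec fun z : α => z.1.getD z.2.1 none :=
    (Primrec.list_getD none).comp Primrec.fst (Primrec.fst.comp Primrec.snd)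
  have hp : Primrec fun z : α => z.2.2 := Primrec.snd.comp Primrec.snd
  have hp₁ : Primrec fun w : α × ℕ => w.1.2.2.1 := Primrec.fst.comp (hp.comp Primrec.fst)
  have hp₂ : Primrec fun w : α × ℕ => w.1.2.2.2 := Primrec.snd.comp (hp.comp Primrec.fst)
  have hk : Primrec fun w : α × ℕ => (w.2 : ℤ) := primrec_natCast_int.comp Primrec.snd
  have hx : ∀ b, Primrec fun w : α × ℕ => clock b w.1.2.1 := fun b =>
    primrec_clock.comp (Primrec.const b) (Primrec.fst.comp (Primrec.snd.comp Primrec.fst))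
  have two : ∀ {f f' : α × ℕ → ℤ} {g g' : α × ℕ → ℕ} {S : α × ℕ → System} (s : Bool),
      Primrec f → Primrec f' → Primrec g → Primrec g' → Primrec S →
      Primrec fun w => ((([(f w, g w), (f' w, g' w)], s) : Ineq) :: S w) :=
    fun s hf hf' hg hg' hS => Primrec.list_cons.comp
      ((primrec_monomial hf hg (primrec_monomial hf' hg' (Primrec.const []))).pair
        (Primrec.const s)) hS
  have one := Primrec.const (α := α × ℕ) (1 : ℤ)
  have negOne := Primrec.const (α := α × ℕ) (-1 : ℤ)
  have hzero := Primrec.const (α := α × ℕ) 0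
  refine (Primrec.option_casesOn (o := fun z : α => z.1.getD z.2.1 none) (f := fun z : α => [z.2.2])
    (g := fun z k =>
      [(([((k : ℤ), 0), (-1, clock 0 z.2.1)], false) :: z.2.2.1,
        ([((1 : ℤ), clock 0 z.2.1), (-1, clock 1 z.2.1)], false) ::
          ([((1 : ℤ), clock 1 z.2.1), (-1, clock 0 z.2.1)], false) :: z.2.2.2),
       (([((1 : ℤ), clock 0 z.2.1), (-(k : ℤ), 0)], true) :: z.2.2.1,
        ([((1 : ℤ), clock 1 z.2.1), (-(k : ℤ), 0)], true) :: z.2.2.2)])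
    hM (Primrec.list_cons.comp hp (Primrec.const [])) ?_).of_eq fun z => ?_
  · exact Primrec.list_cons.comp
      ((two false hk negOne hzero (hx 0) hp₁).pair
        (two false one negOne (hx 0) (hx 1) (two false one negOne (hx 1) (hx 0) hp₂)))
      (Primrec.list_cons.comp
        ((two true one (primrec_int_neg.comp hk) (hx 0) hzero hp₁).pair
          (two true one (primrec_int_neg.comp hk) (hx 1) hzero hp₂))
        (Primrec.const []))
  · rw [splitClock]
    cases z.1.getD z.2.1 none <;> rfl

theorem primrec_splitClocks :
    Primrec fun z : List (Option ℕ) × List ℕ × (System × System) =>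
      splitClocks z.1 z.2.1 z.2.2 := by
  let α := List (Option ℕ) × List ℕ × (System × System)
  refine Primrec.list_foldr (α := α) (β := ℕ) (σ := List (System × System))
    (h := fun z x => x.2.flatMap (splitClock z.1 x.1)) (Primrec.fst.comp Primrec.snd)
    (Primrec.list_cons.comp (Primrec.snd.comp Primrec.snd) (Primrec.const [])) ?_
  refine Primrec.list_flatMap (α := α × ℕ × List (System × System))
    (g := fun w p => splitClock w.1.1 w.2.1 p) (Primrec.snd.comp Primrec.snd) ?_
  exact primrec_splitClock.comp
    (α := (α × ℕ × List (System × System)) × (System × System))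
    ((Primrec.fst.comp (Primrec.fst.comp Primrec.fst)).pair
      ((Primrec.fst.comp (Primrec.snd.comp Primrec.fst)).pair Primrec.snd))

theorem primrec_entails :
    Primrec fun z : ℕ × System × System => entails z.1 z.2.1 z.2.2 := by
  let α := ℕ × System × System
  have hvars : Primrec allVars :=
    Primrec.list_map (Primrec.list_range.comp (Primrec.succ.comp Primrec.nat_double))
      (Primrec.succ.comp Primrec.snd)
  refine primrec_list_all (α := α) (p := fun z c =>
    !((System.elims (allVars z.1) (c.not :: z.2.1)).all Ineq.test))
    (Primrec.snd.comp Primrec.snd) ?_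
  refine Primrec.not.comp (primrec_list_all (α := α × Ineq) (p := fun _ r => Ineq.test r)
    (primrec_elims.comp (hvars.comp (Primrec.fst.comp Primrec.fst))
      (Primrec.list_cons.comp (primrec_not.comp Primrec.snd)
        (Primrec.fst.comp (Primrec.snd.comp Primrec.fst)))) (primrec_test.comp Primrec.snd))

theorem primrec_decideIncluded : Primrec decideIncluded := by
  have hn : Primrec fun x : Input => x.1 := Primrec.fst
  have hM : Primrec fun x : Input => x.2.1 := Primrec.fst.comp Primrec.snd
  have hP : Primrec fun x : Input => x.2.2.1 :=
    Primrec.fst.comp (Primrec.snd.comp Primrec.snd)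
  have hP' : Primrec fun x : Input => x.2.2.2 :=
    Primrec.snd.comp (Primrec.snd.comp Primrec.snd)
  have hd : Primrec commonDenominator :=
    Primrec.nat_mul.comp (primrec_denominator.comp (Primrec.snd.comp hP))
      (primrec_denominator.comp (Primrec.snd.comp hP'))
  have houter : Primrec outerSystem :=
    Primrec.list_cons.comp (Primrec.const _)
      ((primrec_zoneSystem 0).comp hn (Primrec.fst.comp hP))
  have hinner : Primrec innerSystem :=
    Primrec.list_cons.comp
      ((Primrec.list_append.comp
        ((primrec_costForm 0).comp (hn.pair (hd.pair (Primrec.snd.comp hP))))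
        (primrec_monomial (primrec_natCast_int.comp hd) (Primrec.const 1)
          (primrec_scale.comp (Primrec.const (-1))
            ((primrec_costForm 1).comp (hn.pair (hd.pair (Primrec.snd.comp hP'))))))).pair
        (Primrec.const false))
      ((primrec_zoneSystem 1).comp hn (Primrec.fst.comp hP'))
  have hvars : Primrec innerVars :=
    Primrec.list_map Primrec.list_range (primrec_clock.comp (Primrec.const 1) Primrec.snd)
  refine primrec_list_all (p := fun (x : Input) q =>
    entails x.1 q.1 (System.elims (innerVars x.1) q.2))
    (primrec_splitClocks.comp (hM.pair
      ((Primrec.list_range.comp hn).pair (houter.pair hinner)))) ?_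
  exact primrec_entails.comp (α := Input × (System × System))
    ((hn.comp Primrec.fst).pair ((Primrec.fst.comp Primrec.snd).pair
      (primrec_elims.comp (hvars.comp (hn.comp Primrec.fst))
        (Primrec.snd.comp Primrec.snd))))

/-- If the systems constrain no variable beyond those of the clocks, then the condition on these
variables is harmless; it makes the statement true for all systems. -/
theorem entails_eq_false (n : ℕ) (S T : System) :
    entails n S T = false ↔
      ∃ e : ℕ → ℝ, e 0 = 1 ∧ (∀ i, 2 * n + 1 < i → e i = 0) ∧
        System.Holds e S ∧ ¬ System.Holds e T := by
  have htest : ∀ U : System, U.all Ineq.test = true ↔ System.Holds (Pi.single 0 1) U := by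
    intro U
    simp [System.Holds, Ineq.test_iff]
  have hmem : ∀ i, i ∉ allVars n ↔ i = 0 ∨ 2 * n + 1 < i := by
    intro i
    simp only [allVars, List.mem_map, List.mem_range]
    constructor
    · intro h
      by_contra hi
      exact h ⟨i - 1, by omega, by omega⟩
    · rintro h ⟨k, hk, rfl⟩
      omega
  have hfalse : entails n S T = false ↔
      ∃ c ∈ T, (System.elims (allVars n) (c.not :: S)).all Ineq.test = true := by
    rw [entails, List.all_eq_false]
    simp only [Bool.not_eq_true, Bool.not_eq_false']
  simp only [hfalse, htest, System.holds_elims, hmem, System.holds_cons, Ineq.holds_not]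
  constructor
  · rintro ⟨c, hc, e, he, hce, hS⟩
    refine ⟨e, by simpa using he 0 (Or.inl rfl), fun i hi => ?_, hS, fun hT => hce (hT c hc)⟩
    rw [he i (Or.inr hi), Pi.single_eq_of_ne (by omega)]
  · rintro ⟨e, he₀, he, hS, hT⟩
    simp only [System.Holds, not_forall] at hT
    obtain ⟨c, hc, hce⟩ := hT
    refine ⟨c, hc, e, ?_, hce, hS⟩
    rintro i (rfl | hi)
    · simpa using he₀
    · rw [he i hi, Pi.single_eq_of_ne (by omega)]

/-- The assignment that reads the values of the clocks off the valuation `v` and agrees with `e`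
elsewhere. -/
noncomputable def assign {n : ℕ} (b : ℕ) (v : Valuation (Fin n)) (e : ℕ → ℝ) : ℕ → ℝ :=
  Function.extend (fun i : Fin n => clock b i) (fun i => (v i : ℝ)) e

theorem assign_clock {n : ℕ} (b : ℕ) (v : Valuation (Fin n)) (e : ℕ → ℝ) (i : Fin n) :
    assign b v e (clock b i) = v i :=
  Function.Injective.extend_apply
    (fun i j h => Fin.ext (by simp only [clock] at h; omega)) _ _ i

theorem assign_of_ne {n : ℕ} (b : ℕ) (v : Valuation (Fin n)) (e : ℕ → ℝ) (j : ℕ)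
    (h : ∀ i < n, clock b i ≠ j) : assign b v e j = e j :=
  Function.extend_apply' _ _ _ fun ⟨i, hi⟩ => h i i.2 hi

theorem holds_innerSystem {n : ℕ} (M : Fin n → WithBot ℕ) (P P' : Presentation n) (e : ℕ → ℝ)
    (h₀ : e 0 = 1) (v : Valuation (Fin n)) (hv : ∀ i : Fin n, e (clock 0 i) = v i) :
    System.Holds e (innerSystem (input M P P')) ↔
      ∃ v' ∈ P'.toPricedZone.zone, (∀ i : Fin n, e (clock 1 i) = v' i) ∧
        P'.toPricedZone.cost v' ≤ P.toPricedZone.cost v + e 1 := by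
  set d := commonDenominator (input M P P') with hd
  have hpos : (0 : ℝ) < d := by
    exact_mod_cast Nat.mul_pos (denominator_pos P) (denominator_pos P')
  have hcost : ∀ v' : Valuation (Fin n), (∀ i : Fin n, e (clock 1 i) = v' i) →
      (Ineq.Holds e (costForm n d 0 P.code.2 ++ ((d : ℤ), 1) ::
        LinForm.scale (-1) (costForm n d 1 P'.code.2), false) ↔
        P'.toPricedZone.cost v' ≤ P.toPricedZone.cost v + e 1) := by
    intro v' hv'
    rw [Ineq.holds_weak, LinForm.eval_append, LinForm.eval_cons, LinForm.eval_scale,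
      eval_costForm e h₀ 0 d P (dvd_mul_right _ _) v hv,
      eval_costForm e h₀ 1 d P' (dvd_mul_left _ _) v' hv',
      ← sub_nonneg (b := P'.toPricedZone.cost v'),
      ← mul_nonneg_iff_of_pos_left hpos (b := _ - _)]
    push_cast
    ring_nf
  have hsplit : System.Holds e (innerSystem (input M P P')) ↔
      Ineq.Holds e (costForm n d 0 P.code.2 ++ ((d : ℤ), 1) ::
        LinForm.scale (-1) (costForm n d 1 P'.code.2), false) ∧
      System.Holds e (zoneSystem n 1 (P'.constraint.map Atom.code)) :=
    System.holds_cons _ _ _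
  rw [hsplit, holds_zoneSystem e h₀]
  constructor
  · rintro ⟨hc, v', hz, hv'⟩
    exact ⟨v', hz, hv', (hcost v' hv').1 hc⟩
  · rintro ⟨v', hz, hv', hc⟩
    exact ⟨(hcost v' hv').2 hc, v', hz, hv'⟩

/-- For an assignment `e` that satisfies the outer part of a case, eliminating the second valuation
from the inner part yields the existence of a valuation `v'` as in the definition of `⊑_M`. -/
theorem holds_elims_innerVars {n : ℕ} (M : Fin n → WithBot ℕ) (P P' : Presentation n)
    {q : System × System} (hq : q ∈ splitClocks (boundsCode M) (List.range n)
      (outerSystem (input M P P'), innerSystem (input M P P')))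
    {e : ℕ → ℝ} (h₀ : e 0 = 1) (h : System.Holds e q.1) (v : Valuation (Fin n))
    (hv : ∀ i : Fin n, e (clock 0 i) = v i) :
    System.Holds e (System.elims (innerVars n) q.2) ↔
      ∃ v' ∈ P'.toPricedZone.zone, Equivalent M v v' ∧
        P'.toPricedZone.cost v' ≤ P.toPricedZone.cost v + e 1 := by
  have hmem : ∀ j, j ∉ innerVars n ↔ ∀ i < n, clock 1 i ≠ j := by
    intro j
    simp [innerVars]
  have hclock : ∀ i, clock 0 i ∉ innerVars n := by
    intro i
    rw [hmem]
    intro k _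
    simp only [clock]
    omega
  have hone : ∀ j ≤ 1, j ∉ innerVars n := by
    intro j hj
    rw [hmem]
    intro k _
    simp only [clock]
    omega
  have key : ∀ e' : ℕ → ℝ, (∀ j ∉ innerVars n, e' j = e j) → (System.Holds e' q.2 ↔
      ∃ v' ∈ P'.toPricedZone.zone, (∀ i : Fin n, e' (clock 1 i) = v' i) ∧
        Equivalent M v v' ∧ P'.toPricedZone.cost v' ≤ P.toPricedZone.cost v + e 1) := by
    intro e' he'
    have h₀' : e' 0 = 1 := by rw [he' 0 (hone 0 (by omega)), h₀]
    have hv₀ : ∀ i : Fin n, e' (clock 0 i) = v i := fun i => by rw [he' _ (hclock i), hv]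
    rw [holds_snd_of_mem_splitClocks hq h₀ h₀' (fun i _ => he' _ (hclock i)) h,
      holds_innerSystem M P P' e' h₀' v hv₀, he' 1 (hone 1 le_rfl)]
    constructor
    · rintro ⟨⟨v', hz, hv', hc⟩, hM⟩
      exact ⟨v', hz, hv', (forall_matchesAt M e' v v' hv₀ hv').1 hM, hc⟩
    · rintro ⟨v', hz, hv', hM, hc⟩
      exact ⟨⟨v', hz, hv', hc⟩, (forall_matchesAt M e' v v' hv₀ hv').2 hM⟩
  rw [System.holds_elims]
  constructor
  · rintro ⟨e', he', hq'⟩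
    obtain ⟨v', hz, -, hM, hc⟩ := (key e' he').1 hq'
    exact ⟨v', hz, hM, hc⟩
  · rintro ⟨v', hz, hM, hc⟩
    have he' : ∀ j ∉ innerVars n, assign 1 v' e j = e j := fun j hj =>
      assign_of_ne 1 v' e j ((hmem j).1 hj)
    exact ⟨assign 1 v' e, he', (key _ he').2 ⟨v', hz, assign_clock 1 v' e, hM, hc⟩⟩

theorem holds_outerSystem {n : ℕ} (M : Fin n → WithBot ℕ) (P P' : Presentation n) (e : ℕ → ℝ)
    (h₀ : e 0 = 1) :
    System.Holds e (outerSystem (input M P P')) ↔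
      0 < e 1 ∧ ∃ v ∈ P.toPricedZone.zone, ∀ i : Fin n, e (clock 0 i) = v i := by
  have hsplit : System.Holds e (outerSystem (input M P P')) ↔
      Ineq.Holds e ([((1 : ℤ), 1)], true) ∧
      System.Holds e (zoneSystem n 0 (P.constraint.map Atom.code)) :=
    System.holds_cons _ _ _
  rw [hsplit, holds_zoneSystem e h₀]
  simp [Presentation.toPricedZone]

theorem decideIncluded_iff {n : ℕ} (M : Fin n → WithBot ℕ) (P P' : Presentation n) :
    decideIncluded (input M P P') = true ↔ Included M P.toPricedZone P'.toPricedZone := by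
  rw [← not_iff_not, Bool.not_eq_true]
  have hdec : decideIncluded (input M P P') = false ↔
      ∃ q ∈ splitClocks (boundsCode M) (List.range n)
        (outerSystem (input M P P'), innerSystem (input M P P')),
        entails n q.1 (System.elims (innerVars n) q.2) = false := by
    simp [decideIncluded, input, List.all_eq_false]
  rw [hdec]
  simp only [entails_eq_false]
  constructor
  · rintro ⟨q, hq, e, h₀, -, hS, hT⟩ hinc
    obtain ⟨hε, v, hz, hv⟩ :=
      (holds_outerSystem M P P' e h₀).1 (holds_of_mem_splitClocks hq hS)
    exact hT ((holds_elims_innerVars M P P' hq h₀ hS v hv).2 (hinc v hz (e 1) hε))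
  · intro hinc
    simp only [Included, not_forall] at hinc
    obtain ⟨v, hz, ε, hε, hno⟩ := hinc
    set e := assign 0 v (Function.update (Pi.single 0 1) 1 ε) with he
    have hsmall : ∀ j ≤ 1, e j = (Function.update (Pi.single 0 1) 1 ε : ℕ → ℝ) j := fun j hj =>
      assign_of_ne 0 v _ j fun i _ => by simp only [clock]; omega
    have h₀ : e 0 = 1 := by rw [hsmall 0 (by omega)]; simp
    have h₁ : e 1 = ε := by rw [hsmall 1 le_rfl]; simp
    have hv := assign_clock 0 v (Function.update (Pi.single 0 1) 1 ε)
    rw [← he] at hv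
    obtain ⟨q, hq, hS⟩ := exists_splitClocks (boundsCode M) (List.range n)
      (outerSystem (input M P P'), innerSystem (input M P P')) e h₀
      ((holds_outerSystem M P P' e h₀).2 ⟨h₁ ▸ hε, v, hz, hv⟩)
    refine ⟨q, hq, e, h₀, fun i hi => ?_, hS, fun hT => hno ?_⟩
    · rw [he, assign_of_ne 0 v _ i fun k hk => by simp only [clock]; omega,
        Function.update_of_ne (by omega), Pi.single_eq_of_ne (by omega)]
    · have := (holds_elims_innerVars M P P' hq h₀ hS v hv).1 hT
      rwa [h₁] at this

end PricedZones

/-- There is one algorithm which, given the number `n` of clocks, the bounds `M` and presentations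
of two priced zones, decides whether the first is included in the second for `⊑_M`. -/
theorem mainTheorem5 :
    ∃ decideInclusion : PricedZones.Input → Bool,
      Computable decideInclusion ∧
        ∀ (n : ℕ) (M : Fin n → WithBot ℕ) (P P' : PricedZones.Presentation n),
          decideInclusion (PricedZones.input M P P') = true ↔
            PricedZones.Included M P.toPricedZone P'.toPricedZone :=
  ⟨PricedZones.decideIncluded, PricedZones.primrec_decideIncluded.to_comp,
    fun _ M P P' => PricedZones.decideIncluded_iff M P P'⟩
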